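/- Let $q$ be a positive square-free integer with $q\equiv 3 \pmod 8$, all of whose prime factors are congruent to $1$ or $3$ modulo $8$, and let $j$ be an integer with $j^2\equiv -2 \pmod q$. Let $\mathbb K=\mathbb Q(\sqrt2,\sqrt{-q})$ and $\mathbb L=\mathbb Q(\sqrt2,\sqrt q,i)$ (subfields of $\mathbb C$, with $\sqrt{-q}=i\sqrt q$), let $$\alpha_1=1,\quad \alpha_2=\sqrt2,\quad \alpha_3=\frac{1+i\sqrt q}{2},\quad \alpha_4=\frac{\sqrt2+i\sqrt{2q}}{2},$$ and let $$\mathcal M_{j,q}=\Big\{\sum_{k=1}^4 x_k\alpha_k \;:\; x_k\in\mathbb Z,\ x_3\equiv -2x_1+j(2x_2+x_4) \pmod q\Big\}\subset\mathbb K .$$ For a field $F\in\{\mathbb K,\mathbb L\}$ of degree $2r$, order its embeddings $\sigma_1,\dots,\sigma_{2r}$ into $\mathbb C$ so that $\overline{\sigma_{k+r}}=\sigma_k$ for $k=1,\dots,r$ (this is possible, with $r=2$ for $\mathbb K$ and $r=4$ for $\mathbb L$), and let $$\sigma_F(x)=(\Re\sigma_1(x),\Im\sigma_1(x),\dots,\Re\sigma_r(x),\Im\sigma_r(x))\in\mathbb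 R^{2r}$$ be the canonical embedding. Two lattices are called equivalent if one is the image of the other under a linear isometry followed by a scaling by a positive real number, and $D_4$ is the lattice of the points of $\mathbb Z^4$ whose coordinate sum is even. Let $\{z_1,z_2,z_3,z_4\}$ be a $\mathbb Z$-basis of $\mathcal M_{j,q}$, and let $\mathcal S$ be the $\mathbb Z$-module in $\mathbb L$ generated by $z_1,\dots,z_4,iz_1,\dots,iz_4$. Then, for all such orderings of the embeddings of $\mathbb K$ and of $\mathbb L$, $\sigma_{\mathbb L}(\mathcal S)$ is a lattice in $\mathbb R^8$ equivalent to the orthogonal direct sum $D_4\oplus D_4$. Moreover, the vectors $\sigma_{\mathbb L}(z_1),\dots,\sigma_{\mathbb L}(z_4),\sigma_{\mathbb L}(iz_1),\dots,\sigma_{\mathbb L}(iz_4)$ are linearly independent over $\mathbb R$, and their Gram matrix is $$2\begin{bmatrix} G' & 0\\ 0 & G'\end{bmatrix},$$ where $G'$ is the Gram matrix of $\sigma_{\mathbb K}(z_1),\dots,\sigma_{\mathbb K}(z_4)$, a basis of the lattice $\sigma_{\mathbb K}(\mathcal M_{j,q})$. -/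

import Mathlib

open Complex Module

noncomputable section

namespace AlgLattice

/-! ### Canonical embeddings -/

/-- An ordering `σ_1, …, σ_r, σ_{r+1}, …, σ_{2r}` of all the embeddings of a field `F` of degree
`2r` into `ℂ` such that the complex conjugate of `σ_{k+r}` is `σ_k` for `k = 1, …, r`. Here
`σ_k` is `emb (Sum.inl k)` and `σ_{k+r}` is `emb (Sum.inr k)`. -/
structure ConjOrdering (F : Type*) [Field F] (r : ℕ) where
  /-- the enumeration of the embeddings -/
  emb : Fin r ⊕ Fin r ≃ (F →+* ℂ)
  /-- the second half of the embeddings is conjugate to the first half -/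
  conj_emb : ∀ (k : Fin r) (x : F),
    (starRingEnd ℂ) (emb (Sum.inr k) x) = emb (Sum.inl k) x

/-- The canonical embedding `x ↦ (Re σ_1 x, Im σ_1 x, …, Re σ_r x, Im σ_r x)` of `F` into the
Euclidean space `ℝ^{2r}`, whose coordinates are indexed by `Fin r × Fin 2`. -/
def ConjOrdering.embedding {F : Type*} [Field F] {r : ℕ} (σ : ConjOrdering F r) :
    F →ₗ[ℤ] EuclideanSpace ℝ (Fin r × Fin 2) :=
  AddMonoidHom.toIntLinearMap
    { toFun := fun x => WithLp.toLp 2 fun p =>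
        if p.2 = 0 then (σ.emb (Sum.inl p.1) x).re else (σ.emb (Sum.inl p.1) x).im
      map_zero' := by ext p; simp
      map_add' := fun x y => by
        ext p
        by_cases h : p.2 = 0 <;> simp [h] }

/-! ### Lattices -/

/-- Two lattices are equivalent if one is obtained from the other by a linear isometry between
the ambient Euclidean spaces followed by a scaling. -/
def Equivalent {E E' : Type*} [NormedAddCommGroup E] [InnerProductSpace ℝ E]
    [NormedAddCommGroup E'] [InnerProductSpace ℝ E']
    (Λ : Submodule ℤ E) (Λ' : Submodule ℤ E') : Prop :=
  ∃ (c : ℝ) (e : E ≃ₗᵢ[ℝ] E'), 0 < c ∧ (Λ' : Set E') = (fun v => c • e v) '' (Λ : Set E)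

/-- The lattice `D_n`: the points of `ℝ^n` with integer coordinates whose sum is even. -/
def latticeD (n : ℕ) : Submodule ℤ (EuclideanSpace ℝ (Fin n)) :=
  AddSubgroup.toIntSubmodule
    { carrier := {v | ∃ a : Fin n → ℤ, (∀ i, v i = a i) ∧ Even (∑ i, a i)}
      zero_mem' := ⟨0, by simp, by simp⟩
      add_mem' := by
        rintro v w ⟨a, ha, ha'⟩ ⟨b, hb, hb'⟩
        exact ⟨a + b, by simp [ha, hb], by simpa [Finset.sum_add_distrib] using ha'.add hb'⟩
      neg_mem' := by
        rintro v ⟨a, ha, ha'⟩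
        exact ⟨-a, by simp [ha], by simpa using ha'⟩ }

/-- The orthogonal direct sum `Λ ⊕ Λ'`, in the orthogonal direct sum of the ambient spaces. -/
def orthogonalSum {E E' : Type*} [NormedAddCommGroup E] [InnerProductSpace ℝ E]
    [NormedAddCommGroup E'] [InnerProductSpace ℝ E']
    (Λ : Submodule ℤ E) (Λ' : Submodule ℤ E') : Submodule ℤ (WithLp 2 (E × E')) :=
  AddSubgroup.toIntSubmodule
    { carrier := {v | v.fst ∈ Λ ∧ v.snd ∈ Λ'}
      zero_mem' := ⟨by simp, by simp⟩
      add_mem' := fun {v w} hv hw => ⟨Λ.add_mem hv.1 hw.1, Λ'.add_mem hv.2 hw.2⟩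
      neg_mem' := fun {v} hv => ⟨Λ.neg_mem hv.1, Λ'.neg_mem hv.2⟩ }

/-! ### The fields `K = ℚ(√2, √(-q))` and `L = ℚ(√2, √q, i)` inside `ℂ` -/

/-- The field `K = ℚ(√2, √(-q))`, where `√(-q) = √q · i`. -/
abbrev fieldK (q : ℕ) : IntermediateField ℚ ℂ :=
  IntermediateField.adjoin ℚ {((√2 : ℝ) : ℂ), ((√(q : ℝ) : ℝ) : ℂ) * I}

/-- The field `L = ℚ(√2, √q, i)`. -/
abbrev fieldL (q : ℕ) : IntermediateField ℚ ℂ :=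
  IntermediateField.adjoin ℚ {((√2 : ℝ) : ℂ), ((√(q : ℝ) : ℝ) : ℂ), I}

/-- `√2` as an element of `K`. -/
def sqrtTwo (q : ℕ) : fieldK q :=
  ⟨((√2 : ℝ) : ℂ), IntermediateField.subset_adjoin ℚ _ (by simp)⟩

/-- `√(-q) = √q · i` as an element of `K`. -/
def sqrtNegQ (q : ℕ) : fieldK q :=
  ⟨((√(q : ℝ) : ℝ) : ℂ) * I, IntermediateField.subset_adjoin ℚ _ (by simp)⟩

/-- `i` as an element of `L`. -/
def imagUnit (q : ℕ) : fieldL q :=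
  ⟨I, IntermediateField.subset_adjoin ℚ _ (by simp)⟩

theorem fieldK_le_fieldL (q : ℕ) : fieldK q ≤ fieldL q := by
  rw [IntermediateField.adjoin_le_iff]
  rintro x (rfl | rfl)
  · exact IntermediateField.subset_adjoin ℚ _ (by simp)
  · exact mul_mem (IntermediateField.subset_adjoin ℚ _ (by simp))
      (IntermediateField.subset_adjoin ℚ _ (by simp))

/-- The inclusion of `K` in `L`. -/
def inclKL (q : ℕ) : fieldK q →ₐ[ℚ] fieldL q :=
  IntermediateField.inclusion (fieldK_le_fieldL q)

/-! ### The modules `M_{j,q}` and `S` -/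

/-- The integral basis `1, √2, (1 + i√q)/2, (√2 + i√(2q))/2` of `K`. -/
def alpha (q : ℕ) : Fin 4 → fieldK q :=
  ![1, sqrtTwo q, (1 + sqrtNegQ q) / 2, (sqrtTwo q + sqrtTwo q * sqrtNegQ q) / 2]

/-- The module `M_{j,q}` of all `x_1 α_1 + x_2 α_2 + x_3 α_3 + x_4 α_4` with integers `x_k`
such that `x_3 ≡ -2 x_1 + j (2 x_2 + x_4)` modulo `q` (the index `k` of the text is `k - 1` in
the code). -/
def moduleM (j : ℤ) (q : ℕ) : Submodule ℤ (fieldK q) :=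
  AddSubgroup.toIntSubmodule
    { carrier := {x | ∃ a : Fin 4 → ℤ, x = ∑ k, (a k : fieldK q) * alpha q k ∧
        a 2 ≡ -2 * a 0 + j * (2 * a 1 + a 3) [ZMOD q]}
      zero_mem' := ⟨0, by simp, by simp⟩
      add_mem' := by
        rintro x y ⟨a, rfl, ha⟩ ⟨b, rfl, hb⟩
        refine ⟨a + b, by simp [add_mul, Finset.sum_add_distrib], ?_⟩
        have h := ha.add hb
        simp only [Pi.add_apply]
        convert h using 1
        ring
      neg_mem' := by
        rintro x ⟨a, rfl, ha⟩
        refine ⟨-a, by simp [Finset.sum_neg_distrib], ?_⟩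
        have h := ha.neg
        simp only [Pi.neg_apply]
        convert h using 1
        ring }

/-- The elements `z_1, …, z_4, i z_1, …, i z_4` of `L`, for `z_1, …, z_4` in `K`. -/
def generators {q : ℕ} (z : Fin 4 → fieldK q) : Fin 4 ⊕ Fin 4 → fieldL q :=
  Sum.elim (fun k => inclKL q (z k)) (fun k => imagUnit q * inclKL q (z k))

/-- The `ℤ`-module in `L` generated by `z_1, …, z_4, i z_1, …, i z_4`. -/
def moduleS {q : ℕ} (z : Fin 4 → fieldK q) : Submodule ℤ (fieldL q) :=
  Submodule.span ℤ (Set.range (generators z))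

end AlgLattice

end

/-!
Over all embeddings `φ` of a field `F`, the canonical embedding satisfies
`⟪σ x, σ y⟫ = ½ ∑ φ x · conj (φ y)` (`inner_embedding`). For `F = K` and `F = L` the embeddings
correspond to the choices of signs of the generating square roots (`exists_equiv_signs`), because
`K` has degree `4` and `L` has degree `8`; this also yields the orderings by conjugate pairs. Since
every embedding of `K` has two extensions to `L`, with opposite values at `i`, the form of `L`
restricts to twice the form of `K`, makes `K` and `i K` orthogonal, and is invariant under
multiplication by `i`. This is the claim about the Gram matrix.

For the equivalence with `D_4 ⊕ D_4`, write `q = a² + 2b²` with `a ≡ j b` modulo `q`, which Thue's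
lemma provides (`exists_sq_add_two_mul_sq`). With `β = a + b√2` and its conjugate `β' = a - b√2`,
the four elements `(β ± √(-q)) / 2`, `√2 β' / 2`, `√2 √(-q) / 2` of `K` are orthogonal of the same
squared length `q` (`coordForm_frameCoords`), and `M_{j,q}` consists of their integral combinations
with even coefficient sum (`mem_moduleM_iff`): it is a copy of `D_4`. Together with their multiples
by `i` these elements form an orthogonal frame of squared length `2q` in `ℝ⁸` that identifies the
image of `S` with `D_4 ⊕ D_4` (`equivalent_orthogonalSum_latticeD`). The image of `S` therefore
spans `ℝ⁸`, and its eight generators are linearly independent.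
-/

noncomputable section

namespace AlgLattice

/-! ### A representation of `q` by the form `a² + 2b²` -/

/-- Thue's lemma: by the pigeonhole principle, a congruence `x ≡ j y` modulo `q` has a nonzero
solution whose coordinates are at most `√q` in absolute value. -/
theorem exists_small_modEq (q : ℕ) (hq : 0 < q) (j : ℤ) :
    ∃ x y : ℤ, (x ≠ 0 ∨ y ≠ 0) ∧ x ≡ j * y [ZMOD q] ∧ x ^ 2 ≤ q ∧ y ^ 2 ≤ q := by
  have : NeZero q := ⟨hq.ne'⟩
  set m := Nat.sqrt q with hm
  have hm1 : q < (m + 1) * (m + 1) := Nat.lt_succ_sqrt q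
  have hm2 : m * m ≤ q := Nat.sqrt_le q
  let f : Fin (m + 1) × Fin (m + 1) → ZMod q := fun p => (p.1 : ℕ) - j * (p.2 : ℕ)
  obtain ⟨p, p', hne, hpp⟩ := Fintype.exists_ne_map_eq_of_card_lt f (by simpa using hm1)
  have small : ∀ s t : Fin (m + 1), (((s : ℕ) : ℤ) - ((t : ℕ) : ℤ)) ^ 2 ≤ q := by
    intro s t
    have h : (((s : ℕ) : ℤ) - ((t : ℕ) : ℤ)) ^ 2 ≤ (m : ℤ) ^ 2 := by
      apply sq_le_sq'
      · have := t.2; omega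
      · have := s.2; omega
    have : (m : ℤ) * m ≤ q := by exact_mod_cast hm2
    nlinarith
  refine ⟨(p.1 : ℕ) - (p'.1 : ℕ), (p.2 : ℕ) - (p'.2 : ℕ), ?_, ?_, small _ _, small _ _⟩
  · by_contra! h
    apply hne
    ext <;> omega
  · rw [← ZMod.intCast_eq_intCast_iff]
    push_cast
    linear_combination hpp

theorem sq_emod_eight (x : ℤ) : x ^ 2 % 8 = 0 ∨ x ^ 2 % 8 = 1 ∨ x ^ 2 % 8 = 4 := by
  have : x % 8 = 0 ∨ x % 8 = 1 ∨ x % 8 = 2 ∨ x % 8 = 3 ∨ x % 8 = 4 ∨ x % 8 = 5 ∨ x % 8 = 6 ∨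
    x % 8 = 7 := by omega
  rcases this with h | h | h | h | h | h | h | h <;> simp [pow_two, Int.mul_emod, h]

/-- If `j² ≡ -2` modulo `q`, then the small solution of Thue's lemma satisfies `q ∣ x² + 2y² < 3q`.
When `x² + 2y² = 2q`, dividing `x + y√-2` by `√-2` gives a solution of norm `q`. -/
theorem exists_sq_add_two_mul_sq (q : ℕ) (hq8 : q % 8 = 3) (j : ℤ) (hj : j ^ 2 ≡ -2 [ZMOD q]) :
    ∃ a b : ℤ, a ≡ j * b [ZMOD q] ∧ a ^ 2 + 2 * b ^ 2 = q := by
  obtain ⟨x, y, hxy, hmod, hx, hy⟩ := exists_small_modEq q (by omega) j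
  have hx' : x ^ 2 ≠ q := by
    intro h
    have := sq_emod_eight x
    omega
  obtain ⟨c, hc⟩ := hmod.dvd
  obtain ⟨d, hd⟩ := hj.dvd
  have hq0 : (0 : ℤ) < q := by omega
  have key : x ^ 2 + 2 * y ^ 2 = q * (-c * (x + j * y) - d * y ^ 2) := by
    linear_combination -(x + j * y) * hc - y ^ 2 * hd
  set k := -c * (x + j * y) - d * y ^ 2
  have hpos : 0 < x ^ 2 + 2 * y ^ 2 := by
    rcases hxy with h | h <;> positivity
  have hlt : x ^ 2 + 2 * y ^ 2 < q * 3 := by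
    have : x ^ 2 < q := lt_of_le_of_ne hx hx'
    linarith
  have hk0 : 0 < k := by
    rw [key] at hpos
    exact pos_of_mul_pos_right hpos hq0.le
  have hk3 : k < 3 := by
    rw [key] at hlt
    exact lt_of_mul_lt_mul_left hlt hq0.le
  obtain hk | hk : k = 1 ∨ k = 2 := by omega
  · exact ⟨x, y, hmod, by rw [key, hk, mul_one]⟩
  · rw [hk] at key
    have hxe : Even x := by
      have : Even (x ^ 2) := ⟨q - y ^ 2, by linarith⟩
      simpa [Int.even_pow] using this
    obtain ⟨x', rfl⟩ := hxe
    refine ⟨y, -x', ?_, by linarith⟩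
    have hcop : IsCoprime (q : ℤ) 2 := ⟨1, -(q / 2), by omega⟩
    apply Int.modEq_iff_dvd.2
    apply hcop.dvd_of_dvd_mul_left
    exact ⟨j * c + d * y, by linear_combination j * hc + y * hd⟩

/-! ### Embeddings and the trace form -/

/-- Complex conjugation permutes the embeddings of a field, and an element with no real conjugate
tells apart the two members of each conjugate pair; so the embeddings can be ordered by conjugate
pairs. -/
theorem nonempty_conjOrdering {F : Type*} [Field F] [NumberField F] {r : ℕ}
    (hr : finrank ℚ F = 2 * r) (x : F) (hx : ∀ φ : F →+* ℂ, (φ x).im ≠ 0) :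
    Nonempty (ConjOrdering F r) := by
  classical
  let c : {φ : F →+* ℂ // 0 < (φ x).im} ≃ {φ : F →+* ℂ // ¬ 0 < (φ x).im} :=
    { toFun := fun φ => ⟨NumberField.ComplexEmbedding.conjugate φ.1, by
        simpa using φ.2.le⟩
      invFun := fun φ => ⟨NumberField.ComplexEmbedding.conjugate φ.1, by
        simpa using lt_of_le_of_ne (not_lt.1 φ.2) (hx φ.1)⟩
      left_inv := fun φ => by ext; simp
      right_inv := fun φ => by ext; simp }
  have hcard : Fintype.card {φ : F →+* ℂ // 0 < (φ x).im} = r := by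
    have h1 := Fintype.card_congr (Equiv.sumCompl fun φ : F →+* ℂ => 0 < (φ x).im)
    rw [Fintype.card_sum, ← Fintype.card_congr c, NumberField.Embeddings.card, hr] at h1
    omega
  let e := (Fintype.equivFinOfCardEq hcard).symm
  exact ⟨⟨(Equiv.sumCongr e (e.trans c)).trans (Equiv.sumCompl _), fun k x => by simp [c]⟩⟩

/-- Under the canonical embedding, the Euclidean inner product is half of the sum of
`φ x · conj (φ y)` over all embeddings `φ`. -/
theorem inner_embedding {F : Type*} [Field F] [Fintype (F →+* ℂ)] {r : ℕ} (σ : ConjOrdering F r)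
    (x y : F) :
    inner ℝ (σ.embedding x) (σ.embedding y) =
      1 / 2 * ∑ φ : F →+* ℂ, (φ x * starRingEnd ℂ (φ y)).re := by
  rw [← σ.emb.sum_comp, Fintype.sum_sum_type]
  have h : ∀ k, (σ.emb (Sum.inr k) x * starRingEnd ℂ (σ.emb (Sum.inr k) y)).re =
      (σ.emb (Sum.inl k) x * starRingEnd ℂ (σ.emb (Sum.inl k) y)).re := by
    intro k
    simp [← σ.conj_emb]
  simp only [h]
  rw [← two_mul, ← mul_assoc, PiLp.inner_apply, Fintype.sum_prod_type]
  norm_num [ConjOrdering.embedding, Fin.sum_univ_two]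
  exact Finset.sum_congr rfl fun k _ => by ring

/-- If `F ⊆ ℂ` is generated by square roots `g 0, …, g (m-1)` of rational numbers and has degree
`2 ^ m`, then the embeddings of `F` correspond to the choices of signs of the `g i`. -/
theorem exists_equiv_signs (F : IntermediateField ℚ ℂ) [NumberField F] {m : ℕ} (g : Fin m → F)
    (hg : F = IntermediateField.adjoin ℚ (Set.range fun i => (g i : ℂ)))
    (hsq : ∀ i, ∃ r : ℚ, g i ^ 2 = r) (hcard : 2 ^ m ≤ finrank ℚ F) :
    ∃ e : (F →+* ℂ) ≃ (Fin m → Bool), ∀ φ i, φ (g i) = if e φ i then (g i : ℂ) else -(g i : ℂ) := by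
  classical
  let f : (F →+* ℂ) → Fin m → Bool := fun φ i => decide (φ (g i) = g i)
  have hval : ∀ φ i, φ (g i) = if f φ i then (g i : ℂ) else -(g i : ℂ) := by
    intro φ i
    by_cases h : φ (g i) = g i
    · simp [f, h]
    · obtain ⟨r, hr⟩ := hsq i
      have h1 : φ (g i) ^ 2 = (g i : ℂ) ^ 2 := by
        have h2 : (g i : ℂ) ^ 2 = r := by
          have := congrArg (fun x : F => (x : ℂ)) hr
          simpa using this
        rw [← map_pow, hr, h2, map_ratCast]
      simpa [f, h] using (sq_eq_sq_iff_eq_or_eq_neg.1 h1).resolve_left h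
  have hinj : Function.Injective f := by
    intro φ ψ h
    have h1 : RingHom.equivRatAlgHom F ℂ φ = RingHom.equivRatAlgHom F ℂ ψ := by
      apply IntermediateField.algHom_ext_of_eq_adjoin ℚ hg
      rintro _ ⟨i, rfl⟩
      exact (hval φ i).trans ((congrArg (fun s => if s i then (g i : ℂ) else -(g i : ℂ)) h).trans
        (hval ψ i).symm)
    exact (RingHom.equivRatAlgHom F ℂ).injective h1
  have hbij : Function.Bijective f := by
    refine (Fintype.bijective_iff_injective_and_card f).2 ⟨hinj, le_antisymm
      (Fintype.card_le_of_injective f hinj) ?_⟩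
    simpa [NumberField.Embeddings.card] using hcard
  exact ⟨Equiv.ofBijective f hbij, hval⟩

theorem sum_fin_succ_arrow {n : ℕ} {α : Type*} [Fintype α] (f : (Fin (n + 1) → α) → ℝ) :
    ∑ s, f s = ∑ b : α, ∑ t : Fin n → α, f (Matrix.vecCons b t) := by
  rw [← (Fin.consEquiv fun _ => α).sum_comp, Fintype.sum_prod_type]
  rfl

theorem sum_fin_two_arrow_bool (f : (Fin 2 → Bool) → ℝ) :
    ∑ s, f s = ∑ a : Bool, ∑ b : Bool, f ![a, b] := by
  simp only [sum_fin_succ_arrow, Fintype.sum_unique]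
  rfl

theorem sum_fin_three_arrow_bool (f : (Fin 3 → Bool) → ℝ) :
    ∑ s, f s = ∑ a : Bool, ∑ b : Bool, ∑ c : Bool, f ![a, b, c] := by
  simp only [sum_fin_succ_arrow, Fintype.sum_unique]
  rfl

/-! ### The embeddings of `K` and of `L` -/

theorem sqrtTwo_sq (q : ℕ) : sqrtTwo q ^ 2 = 2 := by
  apply Subtype.ext
  change ((√2 : ℝ) : ℂ) ^ 2 = 2
  simp [← ofReal_pow]

theorem sqrtNegQ_sq (q : ℕ) : sqrtNegQ q ^ 2 = -q := by
  apply Subtype.ext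
  simp [sqrtNegQ, ← ofReal_pow, mul_pow]

/-- `√q` as an element of `L`. -/
def sqrtQ (q : ℕ) : fieldL q :=
  ⟨((√(q : ℝ) : ℝ) : ℂ), IntermediateField.subset_adjoin ℚ _ (by simp)⟩

/-- The square roots `√2, √(-q)` that generate `K`. -/
def genK (q : ℕ) : Fin 2 → fieldK q := ![sqrtTwo q, sqrtNegQ q]

/-- The square roots `√2, √q, i` that generate `L`. -/
def genL (q : ℕ) : Fin 3 → fieldL q := ![inclKL q (sqrtTwo q), sqrtQ q, imagUnit q]

theorem coe_inclKL (q : ℕ) (x : fieldK q) : ((inclKL q x : fieldL q) : ℂ) = x :=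
  IntermediateField.coe_inclusion _ x

theorem genK_sq (q : ℕ) (k : Fin 2) : ∃ r : ℚ, genK q k ^ 2 = r := by
  fin_cases k
  · exact ⟨2, by simpa [genK] using sqrtTwo_sq q⟩
  · exact ⟨-q, by simpa [genK] using sqrtNegQ_sq q⟩

theorem genL_sq (q : ℕ) (k : Fin 3) : ∃ r : ℚ, genL q k ^ 2 = r := by
  fin_cases k
  · exact ⟨2, by
      change inclKL q (sqrtTwo q) ^ 2 = _
      rw [← map_pow, sqrtTwo_sq, map_ofNat, Rat.cast_ofNat]⟩
  · refine ⟨q, Subtype.ext ?_⟩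
    simp [genL, sqrtQ, ← ofReal_pow]
  · refine ⟨-1, Subtype.ext ?_⟩
    simp [genL, imagUnit]

theorem fieldK_eq_adjoin (q : ℕ) :
    fieldK q = IntermediateField.adjoin ℚ (Set.range fun k => (genK q k : ℂ)) := by
  have h : (Set.range fun k => (genK q k : ℂ)) = {((√2 : ℝ) : ℂ), ((√(q : ℝ) : ℝ) : ℂ) * I} := by
    ext x
    simp [genK, sqrtTwo, sqrtNegQ, Fin.exists_fin_two, eq_comm]
  rw [h]

theorem fieldL_eq_adjoin (q : ℕ) :
    fieldL q = IntermediateField.adjoin ℚ (Set.range fun k => (genL q k : ℂ)) := by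
  have h : (Set.range fun k => (genL q k : ℂ)) = {((√2 : ℝ) : ℂ), ((√(q : ℝ) : ℝ) : ℂ), I} := by
    ext x
    simp [genL, sqrtTwo, coe_inclKL, sqrtQ, imagUnit, Fin.exists_fin_succ, eq_comm]
  rw [h]

theorem numberField_of_sqrt {F : IntermediateField ℚ ℂ} {m : ℕ} (g : Fin m → F)
    (hg : F = IntermediateField.adjoin ℚ (Set.range fun i => (g i : ℂ)))
    (hsq : ∀ i, ∃ r : ℚ, g i ^ 2 = r) : NumberField F := by
  have : FiniteDimensional ℚ F := by
    rw [hg]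
    apply IntermediateField.finiteDimensional_adjoin
    rintro _ ⟨i, rfl⟩
    obtain ⟨r, hr⟩ := hsq i
    apply IsIntegral.of_pow (n := 2) two_pos
    have h : (g i : ℂ) ^ 2 = algebraMap ℚ ℂ r := by
      have := congrArg (fun x : F => (x : ℂ)) hr
      simpa using this
    rw [h]
    exact isIntegral_algebraMap
  exact { to_charZero := inferInstance, to_finiteDimensional := this }

instance (q : ℕ) : NumberField (fieldK q) :=
  numberField_of_sqrt (genK q) (fieldK_eq_adjoin q) (genK_sq q)

instance (q : ℕ) : NumberField (fieldL q) :=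
  numberField_of_sqrt (genL q) (fieldL_eq_adjoin q) (genL_sq q)

theorem rat_add_mul_sqrt_two_eq_zero {a b : ℚ} (h : (a : ℝ) + b * √2 = 0) : a = 0 ∧ b = 0 := by
  have hb : b = 0 := by
    by_contra hb
    apply (irrational_sqrt_two.ratCast_mul hb).ratCast_add a |>.ne_zero
    simpa using h
  subst hb
  simpa using h

/-- `1, √2, √q, √(2q)` are linearly independent over `ℚ`, because neither `q` nor `2q` is the square
of a rational number. -/
theorem rat_biquadratic_eq_zero {q : ℕ} (hq8 : q % 8 = 3) {a b c d : ℚ}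
    (h : (a : ℝ) + b * √2 + (c + d * √2) * √(q : ℝ) = 0) : a = 0 ∧ b = 0 ∧ c = 0 ∧ d = 0 := by
  have h2 : √2 ^ 2 = (2 : ℝ) := Real.sq_sqrt (by norm_num)
  have hqs : √(q : ℝ) ^ 2 = q := Real.sq_sqrt (by positivity)
  -- Multiply by the conjugate `c - d√2` to make the coefficient of `√q` rational.
  set n : ℚ := c ^ 2 - 2 * d ^ 2 with hn
  by_cases hn0 : n = 0
  · have hcd : c = 0 ∧ d = 0 := by
      have h3 : ((c : ℝ) + d * √2) * ((c : ℝ) + (-d : ℚ) * √2) = 0 := by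
        have : ((c ^ 2 - 2 * d ^ 2 : ℚ) : ℝ) = 0 := by rw [← hn, hn0]; simp
        push_cast at this ⊢
        linear_combination this - d ^ 2 * h2
      rcases mul_eq_zero.1 h3 with h4 | h4
      · exact rat_add_mul_sqrt_two_eq_zero h4
      · simpa using rat_add_mul_sqrt_two_eq_zero h4
    obtain ⟨rfl, rfl⟩ := hcd
    simpa using rat_add_mul_sqrt_two_eq_zero (by simpa using h)
  · exfalso
    -- Now `√q = e + f√2` with rational `e, f`; squaring gives `e f = 0`.
    set e : ℚ := -(a * c - 2 * b * d) / n with he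
    set f : ℚ := -(b * c - a * d) / n with hf
    have hn0' : (n : ℝ) ≠ 0 := by exact_mod_cast hn0
    have h5 : √(q : ℝ) = e + f * √2 := by
      have h6 : (n : ℝ) * √(q : ℝ) = -(a * c - 2 * b * d) + -(b * c - a * d) * √2 := by
        rw [hn]
        push_cast
        linear_combination (c - d * √2) * h + (b * d + d ^ 2 * √(q : ℝ)) * h2
      rw [he, hf]
      push_cast
      field_simp
      linear_combination h6
    have h7 : ((e ^ 2 + 2 * f ^ 2 - q : ℚ) : ℝ) + (2 * e * f : ℚ) * √2 = 0 := by
      push_cast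
      rw [h5] at hqs
      linear_combination hqs - f ^ 2 * h2
    obtain ⟨h8, h9⟩ := rat_add_mul_sqrt_two_eq_zero h7
    have hint : ∀ (x : ℚ) (k : ℕ), x ^ 2 = k → ∃ y : ℤ, y ^ 2 = k := by
      intro x k hx
      have h := Rat.isSquare_natCast_iff.1 ⟨x, by rw [← hx, pow_two]⟩
      obtain ⟨y, hy⟩ := h
      exact ⟨y, by rw [hy]; push_cast; ring⟩
    rcases mul_eq_zero.1 h9 with h10 | h10
    · have he0 : e = 0 := by linarith
      obtain ⟨y, hy⟩ := hint (2 * f) (2 * q) (by push_cast; rw [he0] at h8; linarith)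
      have := sq_emod_eight y
      omega
    · obtain ⟨y, hy⟩ := hint e q (by rw [h10] at h8; linarith)
      have := sq_emod_eight y
      omega

theorem sqrt_natCast_ne_zero {q : ℕ} (hq8 : q % 8 = 3) : √(q : ℝ) ≠ 0 :=
  (Real.sqrt_pos.2 (by exact_mod_cast (by omega : 0 < q))).ne'

theorem two_pow_le_finrank_fieldK {q : ℕ} (hq8 : q % 8 = 3) : 2 ^ 2 ≤ finrank ℚ (fieldK q) := by
  have h : LinearIndependent ℚ ![1, sqrtTwo q, sqrtNegQ q, sqrtTwo q * sqrtNegQ q] := by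
    rw [Fintype.linearIndependent_iff]
    intro c hc
    have hc' := congrArg (fun x : fieldK q => (x : ℂ)) hc
    simp only [Fin.sum_univ_four, Rat.smul_def, sqrtTwo, sqrtNegQ] at hc'
    have hre := congrArg Complex.re hc'
    have him := congrArg Complex.im hc'
    simp at hre him
    have h1 := rat_add_mul_sqrt_two_eq_zero hre
    have h2 : ((c 2 : ℝ) + c 3 * √2) * √(q : ℝ) = 0 := by linear_combination him
    have h3 := rat_add_mul_sqrt_two_eq_zero
      ((mul_eq_zero.1 h2).resolve_right (sqrt_natCast_ne_zero hq8))
    intro k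
    fin_cases k
    exacts [h1.1, h1.2, h3.1, h3.2]
  simpa using h.fintype_card_le_finrank

theorem two_pow_le_finrank_fieldL {q : ℕ} (hq8 : q % 8 = 3) : 2 ^ 3 ≤ finrank ℚ (fieldL q) := by
  let s := inclKL q (sqrtTwo q)
  let i := imagUnit q
  let t := sqrtQ q
  have h : LinearIndependent ℚ ![1, s, t, s * t, i, i * s, i * t, i * (s * t)] := by
    rw [Fintype.linearIndependent_iff]
    intro c hc
    have hc' := congrArg (fun x : fieldL q => (x : ℂ)) hc
    simp only [Fin.sum_univ_eight, Rat.smul_def, s, i, t] at hc'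
    have hre := congrArg Complex.re hc'
    have him := congrArg Complex.im hc'
    simp [coe_inclKL, sqrtTwo, sqrtQ, imagUnit] at hre him
    obtain ⟨h0, h1, h2, h3⟩ := rat_biquadratic_eq_zero hq8 (a := c 0) (b := c 1) (c := c 2)
      (d := c 3) (by linear_combination hre)
    obtain ⟨h4, h5, h6, h7⟩ := rat_biquadratic_eq_zero hq8 (a := c 4) (b := c 5) (c := c 6)
      (d := c 7) (by linear_combination him)
    intro k
    fin_cases k
    exacts [h0, h1, h2, h3, h4, h5, h6, h7]
  simpa using h.fintype_card_le_finrank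

theorem exists_equiv_signs_fieldK {q : ℕ} (hq8 : q % 8 = 3) :
    ∃ e : (fieldK q →+* ℂ) ≃ (Fin 2 → Bool), ∀ φ,
      φ (sqrtTwo q) = (if e φ 0 then (√2 : ℂ) else -√2) ∧
      φ (sqrtNegQ q) = if e φ 1 then √(q : ℝ) * I else -(√(q : ℝ) * I) := by
  obtain ⟨e, he⟩ := exists_equiv_signs (fieldK q) (genK q) (fieldK_eq_adjoin q) (genK_sq q)
    (two_pow_le_finrank_fieldK hq8)
  exact ⟨e, fun φ => ⟨he φ 0, he φ 1⟩⟩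

theorem exists_equiv_signs_fieldL {q : ℕ} (hq8 : q % 8 = 3) :
    ∃ e : (fieldL q →+* ℂ) ≃ (Fin 3 → Bool), ∀ φ,
      φ (inclKL q (sqrtTwo q)) = (if e φ 0 then (√2 : ℂ) else -√2) ∧
      φ (inclKL q (sqrtNegQ q)) =
        (if e φ 1 then (√(q : ℝ) : ℂ) else -√(q : ℝ)) * (if e φ 2 then I else -I) ∧
      φ (imagUnit q) = if e φ 2 then I else -I := by
  obtain ⟨e, he⟩ := exists_equiv_signs (fieldL q) (genL q) (fieldL_eq_adjoin q) (genL_sq q)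
    (two_pow_le_finrank_fieldL hq8)
  have hmul : inclKL q (sqrtNegQ q) = sqrtQ q * imagUnit q :=
    Subtype.ext (coe_inclKL q _)
  refine ⟨e, fun φ => ⟨he φ 0, ?_, he φ 2⟩⟩
  rw [hmul, map_mul]
  exact congrArg₂ _ (he φ 1) (he φ 2)

theorem nonempty_conjOrdering_fieldK {q : ℕ} (hq8 : q % 8 = 3) :
    Nonempty (ConjOrdering (fieldK q) 2) := by
  obtain ⟨e, he⟩ := exists_equiv_signs_fieldK hq8
  refine nonempty_conjOrdering ?_ (sqrtNegQ q) fun φ => ?_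
  · rw [← NumberField.Embeddings.card (fieldK q) ℂ, Fintype.card_congr e]
    simp
  · rw [(he φ).2]
    split_ifs <;> simpa using sqrt_natCast_ne_zero hq8

theorem nonempty_conjOrdering_fieldL {q : ℕ} (hq8 : q % 8 = 3) :
    Nonempty (ConjOrdering (fieldL q) 4) := by
  obtain ⟨e, he⟩ := exists_equiv_signs_fieldL hq8
  refine nonempty_conjOrdering ?_ (imagUnit q) fun φ => ?_
  · rw [← NumberField.Embeddings.card (fieldL q) ℂ, Fintype.card_congr e]
    simp
  · rw [(he φ).2.2]
    split_ifs <;> simp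

/-! ### The trace form in coordinates -/

/-- The element `x₀ + x₁ √2 + (x₂ + x₃ √2) √(-q)` of `K`. -/
def ofCoords (q : ℕ) (x : Fin 4 → ℚ) : fieldK q :=
  x 0 + x 1 * sqrtTwo q + (x 2 + x 3 * sqrtTwo q) * sqrtNegQ q

/-- Half of the trace form `(x, y) ↦ Tr (x ȳ)` of `K`, in the coordinates of `ofCoords`. -/
def coordForm (q : ℕ) (x y : Fin 4 → ℚ) : ℚ :=
  2 * (x 0 * y 0 + 2 * (x 1 * y 1) + q * (x 2 * y 2) + 2 * q * (x 3 * y 3))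

theorem inner_embedding_fieldK {q : ℕ} (hq8 : q % 8 = 3) (τ : ConjOrdering (fieldK q) 2)
    (x y : Fin 4 → ℚ) :
    inner ℝ (τ.embedding (ofCoords q x)) (τ.embedding (ofCoords q y)) = coordForm q x y := by
  obtain ⟨e, he⟩ := exists_equiv_signs_fieldK hq8
  have h2 : √2 ^ 2 = (2 : ℝ) := Real.sq_sqrt (by norm_num)
  have hqs : √(q : ℝ) ^ 2 = q := Real.sq_sqrt (by positivity)
  rw [inner_embedding, ← e.symm.sum_comp]
  simp only [ofCoords, map_add, map_mul, map_ratCast, (he _).1, (he _).2, Equiv.apply_symm_apply]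
  simp only [sum_fin_two_arrow_bool, Fintype.sum_bool]
  simp [coordForm]
  ring_nf
  simp only [h2, hqs]
  ring

theorem inner_embedding_fieldL {q : ℕ} (hq8 : q % 8 = 3) (σ : ConjOrdering (fieldL q) 4)
    (x y : Fin 4 → ℚ) :
    inner ℝ (σ.embedding (inclKL q (ofCoords q x))) (σ.embedding (inclKL q (ofCoords q y))) =
      2 * coordForm q x y := by
  obtain ⟨e, he⟩ := exists_equiv_signs_fieldL hq8
  have h2 : √2 ^ 2 = (2 : ℝ) := Real.sq_sqrt (by norm_num)
  have hqs : √(q : ℝ) ^ 2 = q := Real.sq_sqrt (by positivity)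
  rw [inner_embedding, ← e.symm.sum_comp]
  simp only [ofCoords, map_add, map_mul, map_ratCast, (he _).1, (he _).2.1, Equiv.apply_symm_apply]
  simp only [sum_fin_three_arrow_bool, Fintype.sum_bool]
  simp [coordForm]
  ring_nf
  simp only [h2, hqs]
  ring

/-- `K` and `i K` are orthogonal: the embeddings of `L` that agree on `K` pair up with opposite
values at `i`. -/
theorem inner_embedding_imagUnit_mul {q : ℕ} (hq8 : q % 8 = 3) (σ : ConjOrdering (fieldL q) 4)
    (x y : Fin 4 → ℚ) :
    inner ℝ (σ.embedding (inclKL q (ofCoords q x)))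
      (σ.embedding (imagUnit q * inclKL q (ofCoords q y))) = 0 := by
  obtain ⟨e, he⟩ := exists_equiv_signs_fieldL hq8
  rw [inner_embedding, ← e.symm.sum_comp]
  simp only [ofCoords, map_add, map_mul, map_ratCast, (he _).1, (he _).2.1, (he _).2.2,
    Equiv.apply_symm_apply]
  simp only [sum_fin_three_arrow_bool, Fintype.sum_bool]
  simp
  ring

/-- Multiplication by `i` is an isometry, since `φ i · conj (φ i) = 1` for every embedding `φ`. -/
theorem inner_embedding_imagUnit_mul_imagUnit_mul {q : ℕ} {r : ℕ} (σ : ConjOrdering (fieldL q) r)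
    (x y : fieldL q) :
    inner ℝ (σ.embedding (imagUnit q * x)) (σ.embedding (imagUnit q * y)) =
      inner ℝ (σ.embedding x) (σ.embedding y) := by
  rw [inner_embedding, inner_embedding]
  congr 1
  refine Finset.sum_congr rfl fun φ _ => ?_
  have h1 : φ (imagUnit q) ^ 2 = I ^ 2 := by
    have h : imagUnit q ^ 2 = -1 := Subtype.ext (by simp [imagUnit])
    rw [← map_pow, h]
    simp
  rcases sq_eq_sq_iff_eq_or_eq_neg.1 h1 with h | h <;> simp [h]

/-! ### Lattices spanned by orthogonal vectors of equal length -/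

/-- The vectors of `ℤ^n` with even coordinate sum, copied along two orthogonal frames of vectors
that all have the same length, form a lattice equivalent to `D_n ⊕ D_n`. -/
theorem equivalent_orthogonalSum_latticeD {E : Type*} [NormedAddCommGroup E]
    [InnerProductSpace ℝ E] [FiniteDimensional ℝ E] {n : ℕ} (hE : finrank ℝ E = n + n) {N : ℝ}
    (hN : 0 < N) (u v : Fin n → E) (huu : ∀ k l, inner ℝ (u k) (u l) = if k = l then N else 0)
    (hvv : ∀ k l, inner ℝ (v k) (v l) = if k = l then N else 0)
    (huv : ∀ k l, inner ℝ (u k) (v l) = 0) (Λ : Submodule ℤ E)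
    (hΛ : ∀ x, x ∈ Λ ↔ ∃ a b : Fin n → ℤ, Even (∑ k, a k) ∧ Even (∑ k, b k) ∧
      x = ∑ k, a k • u k + ∑ k, b k • v k) :
    Equivalent Λ (orthogonalSum (latticeD n) (latticeD n)) ∧
      Submodule.span ℝ (Λ : Set E) = ⊤ := by
  have hs : √N ≠ 0 := (Real.sqrt_pos.2 hN).ne'
  have hNN : (√N)⁻¹ * ((√N)⁻¹ * N) = 1 := by
    have h : √N * √N = N := Real.mul_self_sqrt hN.le
    field_simp
    linarith
  set w : Fin n ⊕ Fin n → E := fun i => (√N)⁻¹ • Sum.elim u v i with hw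
  have hvu : ∀ k l, inner ℝ (v k) (u l) = 0 := fun k l => by rw [real_inner_comm]; exact huv l k
  have hon : Orthonormal ℝ w := by
    rw [orthonormal_iff_ite]
    rintro (k | k) (l | l) <;>
      simp [hw, inner_smul_left, inner_smul_right, huu, hvv, huv, hvu, hNN]
  have hspan : ⊤ ≤ Submodule.span ℝ (Set.range w) :=
    (hon.linearIndependent.span_eq_top_of_card_eq_finrank' (by simp [hE])).ge
  let b : OrthonormalBasis (Fin n ⊕ Fin n) ℝ E := OrthonormalBasis.mk hon hspan
  let b' := (EuclideanSpace.basisFun (Fin n) ℝ).prod (EuclideanSpace.basisFun (Fin n) ℝ)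
  let e : E ≃ₗᵢ[ℝ] WithLp 2 (EuclideanSpace ℝ (Fin n) × EuclideanSpace ℝ (Fin n)) :=
    b.equiv b' (Equiv.refl _)
  have hew : ∀ i, e (w i) = b' i := by
    intro i
    have : w i = b i := by simp [b]
    rw [this]
    simp [e]
  have hesum : ∀ i, (√N)⁻¹ • e (Sum.elim u v i) = b' i := fun i => by rw [← map_smul, ← hew i]
  have hu : ∀ k, (√N)⁻¹ • e (u k) = b' (Sum.inl k) := fun k => hesum (Sum.inl k)
  have hv : ∀ k, (√N)⁻¹ • e (v k) = b' (Sum.inr k) := fun k => hesum (Sum.inr k)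
  have hmap : ∀ x y : Fin n → ℤ, (√N)⁻¹ • e (∑ k, x k • u k + ∑ k, y k • v k) =
      WithLp.toLp 2 (WithLp.toLp 2 fun k => (x k : ℝ), WithLp.toLp 2 fun k => (y k : ℝ)) := by
    intro x y
    have h1 : (√N)⁻¹ • e (∑ k, x k • u k + ∑ k, y k • v k) =
        ∑ k, (x k : ℝ) • b' (Sum.inl k) + ∑ k, (y k : ℝ) • b' (Sum.inr k) := by
      simp only [map_add, map_sum, map_zsmul, smul_add, Finset.smul_sum, ← hu, ← hv,
        Int.cast_smul_eq_zsmul, smul_comm _ (√N)⁻¹]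
    have h2 : ∀ x : Fin n → ℤ, ∑ k, (x k : ℝ) • EuclideanSpace.basisFun (Fin n) ℝ k =
        WithLp.toLp 2 fun k => (x k : ℝ) := by
      intro x
      ext l
      simp [Finset.sum_apply, Pi.single_apply]
    rw [h1]
    apply (WithLp.linearEquiv 2 ℝ _).injective
    refine Prod.ext ?_ ?_
    · simpa [b', Prod.fst_sum, Prod.snd_sum] using h2 x
    · simpa [b', Prod.fst_sum, Prod.snd_sum] using h2 y
  constructor
  · refine ⟨(√N)⁻¹, e, inv_pos.2 (Real.sqrt_pos.2 hN), ?_⟩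
    ext x
    constructor
    · rintro ⟨⟨x₁, h₁, h₁'⟩, ⟨x₂, h₂, h₂'⟩⟩
      refine ⟨_, (hΛ _).2 ⟨x₁, x₂, h₁', h₂', rfl⟩, ?_⟩
      simp only [hmap]
      apply (WithLp.linearEquiv 2 ℝ _).injective
      refine Prod.ext ?_ ?_
      · ext k
        exact (h₁ k).symm
      · ext k
        exact (h₂ k).symm
    · rintro ⟨y, hy, rfl⟩
      obtain ⟨x₁, x₂, h₁, h₂, rfl⟩ := (hΛ y).1 hy
      simp only [hmap]
      exact ⟨⟨x₁, fun _ => rfl, h₁⟩, ⟨x₂, fun _ => rfl, h₂⟩⟩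
  · -- The doubled frame vectors lie in the lattice.
    rw [eq_top_iff]
    refine hspan.trans (Submodule.span_le.2 ?_)
    have hmem : ∀ i, Sum.elim u v i ∈ Submodule.span ℝ (Λ : Set E) := by
      intro i
      have h2 : (2 : ℤ) • Sum.elim u v i ∈ Λ := by
        rw [hΛ]
        rcases i with k | k
        · refine ⟨Pi.single k 2, 0, ?_, ?_, ?_⟩ <;> simp [Pi.single_apply, ite_smul]
        · refine ⟨0, Pi.single k 2, ?_, ?_, ?_⟩ <;> simp [Pi.single_apply, ite_smul]
      have h3 := Submodule.smul_mem _ (2⁻¹ : ℝ) (Submodule.subset_span (R := ℝ) h2)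
      rwa [← Int.cast_smul_eq_zsmul ℝ, smul_smul, show (2⁻¹ : ℝ) * ((2 : ℤ) : ℝ) = 1 by norm_num,
        one_smul] at h3
    rintro _ ⟨i, rfl⟩
    exact Submodule.smul_mem _ _ (hmem i)

/-! ### An orthogonal frame for `M_{j,q}` -/

/-- Coordinates of the elements `(β + √(-q)) / 2`, `(β - √(-q)) / 2`, `√2 β' / 2`, `√2 √(-q) / 2` of
`K`, where `β = a + b √2` has conjugate `β' = a - b √2`. -/
def frameCoords (a b : ℤ) : Fin 4 → Fin 4 → ℚ :=
  ![![a / 2, b / 2, 1 / 2, 0], ![a / 2, b / 2, -1 / 2, 0], ![-b, a / 2, 0, 0], ![0, 0, 0, 1 / 2]]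

/-- The elements of `K` with coordinates `frameCoords`. -/
def frame (q : ℕ) (a b : ℤ) (k : Fin 4) : fieldK q := ofCoords q (frameCoords a b k)

theorem coordForm_frameCoords {q : ℕ} {a b : ℤ} (hab : a ^ 2 + 2 * b ^ 2 = q) (k l : Fin 4) :
    coordForm q (frameCoords a b k) (frameCoords a b l) = if k = l then (q : ℚ) else 0 := by
  have h : (a : ℚ) ^ 2 + 2 * b ^ 2 = q := by exact_mod_cast hab
  fin_cases k <;> fin_cases l <;> simp [coordForm, frameCoords] <;> linarith

/-- With respect to the frame, the congruence that defines `M_{j,q}` becomes the parity condition of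
`D_4`. Indeed put `X = 2x₁ + x₃` and `Y = 2x₂ + x₄`: as `j² ≡ -2`, the condition `X ≡ jY` says that
`X + Y√-2` is a multiple `(a + b√-2)(u + v√-2)` of the element of norm `q` with `a ≡ jb`. As `a` and
`b` are odd, `x₃ ≡ u` and `x₄ ≡ u + v` modulo `2`, so that `s = (u + x₃) / 2` and `t = (u - x₃) / 2`
are integers with `s + t + v + x₄` even; these are the coordinates along the frame. -/
theorem mem_moduleM_iff {q : ℕ} (hq8 : q % 8 = 3) {j : ℤ} (hj : j ^ 2 ≡ -2 [ZMOD q]) {a b : ℤ}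
    (hmod : a ≡ j * b [ZMOD q]) (hab : a ^ 2 + 2 * b ^ 2 = q) (x : fieldK q) :
    x ∈ moduleM j q ↔ ∃ n : Fin 4 → ℤ, Even (∑ k, n k) ∧ x = ∑ k, n k • frame q a b k := by
  obtain ⟨c, hc⟩ := hmod.dvd
  obtain ⟨d, hd⟩ := hj.dvd
  have hq0 : (q : ℤ) ≠ 0 := by omega
  have ha : Odd a := by
    rw [← Int.not_even_iff_odd]
    rintro ⟨k, rfl⟩
    ring_nf at hab
    omega
  have hb : Odd b := by
    rw [← Int.not_even_iff_odd]
    rintro ⟨k, rfl⟩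
    obtain ⟨l, rfl⟩ := ha
    have h := Int.even_mul_succ_self l
    obtain ⟨i, hi⟩ := h
    ring_nf at hab hi
    omega
  obtain ⟨a', ha'⟩ := ha
  obtain ⟨b', hb'⟩ := hb
  constructor
  · rintro ⟨x, rfl, hx⟩
    obtain ⟨f, hf⟩ := hx.dvd
    set X := 2 * x 0 + x 2 with hX
    set Y := 2 * x 1 + x 3 with hY
    have hXY : j * Y - X = q * f := by rw [← hf, hX, hY]; ring
    obtain ⟨u, hu⟩ : (q : ℤ) ∣ a * X + 2 * b * Y :=
      ⟨-c * X - j * b * f - b * Y * d, by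
        linear_combination -X * hc - j * b * hXY - b * Y * hd⟩
    obtain ⟨v, hv⟩ : (q : ℤ) ∣ a * Y - b * X :=
      ⟨-c * Y + b * f, by linear_combination -Y * hc + b * hXY⟩
    have h1 : X = a * u - 2 * b * v := by
      apply mul_left_cancel₀ hq0
      linear_combination -X * hab + a * hu - 2 * b * hv
    have h2 : Y = a * v + b * u := by
      apply mul_left_cancel₀ hq0
      linear_combination -Y * hab + b * hu + a * hv
    obtain ⟨s, hs⟩ : ∃ s, u + x 2 = 2 * s :=
      ⟨x 0 + x 2 - a' * u + b * v, by linear_combination -h1 + hX - u * ha'⟩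
    obtain ⟨m, hm⟩ : ∃ m, u + v + x 3 = 2 * m :=
      ⟨x 1 + x 3 - a' * v - b' * u, by linear_combination -h2 + hY - v * ha' - u * hb'⟩
    refine ⟨![s, s - x 2, v, x 3], ⟨m, ?_⟩, ?_⟩
    · simp [Fin.sum_univ_four]
      linarith
    · have e1 : (2 * x 0 + x 2 : fieldK q) = a * (2 * s - x 2) - 2 * b * v := by
        have : 2 * x 0 + x 2 = a * (2 * s - x 2) - 2 * b * v := by rw [← hs, ← hX, h1]; ring
        exact_mod_cast this
      have e2 : (2 * x 1 + x 3 : fieldK q) = a * v + b * (2 * s - x 2) := by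
        have : 2 * x 1 + x 3 = a * v + b * (2 * s - x 2) := by rw [← hs, ← hY, h2]; ring
        exact_mod_cast this
      simp [Fin.sum_univ_four, alpha, frame, ofCoords, frameCoords]
      linear_combination (1 / 2 : fieldK q) * e1 + (1 / 2 : fieldK q) * sqrtTwo q * e2
  · rintro ⟨n, ⟨m, hm⟩, rfl⟩
    rw [Fin.sum_univ_four] at hm
    set u := n 0 + n 1 with hu
    refine ⟨![a' * u - b * n 2 + n 1, a' * n 2 + b' * u + m - n 3, n 0 - n 1, n 3], ?_, ?_⟩
    · have ha2 : (a : fieldK q) = 2 * a' + 1 := by exact_mod_cast ha'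
      have hb2 : (b : fieldK q) = 2 * b' + 1 := by exact_mod_cast hb'
      have hm2 : (n 0 + n 1 + n 2 + n 3 : fieldK q) = m + m := by exact_mod_cast hm
      simp [Fin.sum_univ_four, alpha, frame, ofCoords, frameCoords, hu, ha2, hb2]
      linear_combination (1 / 2 : fieldK q) * sqrtTwo q * hm2
    · apply Int.modEq_iff_dvd.2
      refine ⟨c * u - c * j * n 2 - d * b * n 2, ?_⟩
      simp
      linear_combination u * hc - j * n 2 * hc - b * n 2 * hd -
        j * (n 2 * ha' + u * hb' + hm) + u * ha' + hu

/-! ### The lattice of `S` -/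

theorem mem_moduleS_iff {q : ℕ} {j : ℤ} (z : Module.Basis (Fin 4) ℤ (moduleM j q)) (x : fieldL q) :
    x ∈ moduleS (fun k => (z k : fieldK q)) ↔
      ∃ y ∈ moduleM j q, ∃ y' ∈ moduleM j q, x = inclKL q y + imagUnit q * inclKL q y' := by
  have hz : Submodule.span ℤ (Set.range fun k => (z k : fieldK q)) = moduleM j q := by
    have h := congrArg (Submodule.map (moduleM j q).subtype) z.span_eq
    rwa [Submodule.map_span, ← Set.range_comp, Submodule.map_subtype_top] at h
  let f : fieldK q →ₗ[ℤ] fieldL q := (inclKL q).toLinearMap.restrictScalars ℤ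
  let g : fieldK q →ₗ[ℤ] fieldL q := LinearMap.mulLeft ℤ (imagUnit q) ∘ₗ f
  have hS : moduleS (fun k => (z k : fieldK q)) =
      (moduleM j q).map f ⊔ (moduleM j q).map g := by
    conv_rhs => rw [← hz]
    rw [moduleS, generators, Set.Sum.elim_range, Submodule.span_union, Submodule.map_span,
      Submodule.map_span, ← Set.range_comp, ← Set.range_comp]
    rfl
  rw [hS, Submodule.mem_sup]
  constructor
  · rintro ⟨_, ⟨y, hy, rfl⟩, _, ⟨y', hy', rfl⟩, rfl⟩
    exact ⟨y, hy, y', hy', rfl⟩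
  · rintro ⟨y, hy, y', hy', rfl⟩
    exact ⟨_, ⟨y, hy, rfl⟩, _, ⟨y', hy', rfl⟩, rfl⟩

theorem exists_ofCoords_of_mem_moduleM {q : ℕ} {j : ℤ} {x : fieldK q} (hx : x ∈ moduleM j q) :
    ∃ c, x = ofCoords q c := by
  obtain ⟨n, rfl, -⟩ := hx
  refine ⟨![n 0 + n 2 / 2, n 1 + n 3 / 2, n 2 / 2, n 3 / 2], ?_⟩
  simp [Fin.sum_univ_four, alpha, ofCoords]
  ring

end AlgLattice

end

theorem mainTheorem4 (q : ℕ) (hq : Squarefree q) (hq8 : q % 8 = 3)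
    (hqp : ∀ p : ℕ, p.Prime → p ∣ q → p % 8 = 1 ∨ p % 8 = 3)
    (j : ℤ) (hj : j ^ 2 ≡ -2 [ZMOD q])
    (z : Module.Basis (Fin 4) ℤ (AlgLattice.moduleM j q)) :
    Nonempty (AlgLattice.ConjOrdering (AlgLattice.fieldK q) 2) ∧
    Nonempty (AlgLattice.ConjOrdering (AlgLattice.fieldL q) 4) ∧
    ∀ (τ : AlgLattice.ConjOrdering (AlgLattice.fieldK q) 2)
      (σ : AlgLattice.ConjOrdering (AlgLattice.fieldL q) 4),
      AlgLattice.Equivalent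
        ((AlgLattice.moduleS fun k => (z k : AlgLattice.fieldK q)).map σ.embedding)
        (AlgLattice.orthogonalSum (AlgLattice.latticeD 4) (AlgLattice.latticeD 4)) ∧
      LinearIndependent ℝ
        (fun k => σ.embedding
          (AlgLattice.generators (fun k => (z k : AlgLattice.fieldK q)) k)) ∧
      Matrix.gram ℝ
        (fun k => σ.embedding
          (AlgLattice.generators (fun k => (z k : AlgLattice.fieldK q)) k)) =
        (2 : ℝ) • Matrix.fromBlocks
          (Matrix.gram ℝ fun k => τ.embedding (z k : AlgLattice.fieldK q)) 0
          0 (Matrix.gram ℝ fun k => τ.embedding (z k : AlgLattice.fieldK q)) := by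
  open AlgLattice in
  refine ⟨nonempty_conjOrdering_fieldK hq8, nonempty_conjOrdering_fieldL hq8, fun τ σ => ?_⟩
  obtain ⟨a, b, hmod, hab⟩ := exists_sq_add_two_mul_sq q hq8 j hj
  have hM := mem_moduleM_iff hq8 hj hmod hab
  let u : Fin 4 → EuclideanSpace ℝ (Fin 4 × Fin 2) :=
    fun k => σ.embedding (inclKL q (frame q a b k))
  let v : Fin 4 → EuclideanSpace ℝ (Fin 4 × Fin 2) :=
    fun k => σ.embedding (imagUnit q * inclKL q (frame q a b k))
  have hform : ∀ k l, (2 * coordForm q (frameCoords a b k) (frameCoords a b l) : ℝ) =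
      if k = l then (2 * q : ℝ) else 0 := by
    intro k l
    rw [coordForm_frameCoords hab]
    split_ifs <;> simp
  have huu : ∀ k l, inner ℝ (u k) (u l) = if k = l then (2 * q : ℝ) else 0 := fun k l => by
    rw [← hform]
    exact inner_embedding_fieldL hq8 σ _ _
  have hvv : ∀ k l, inner ℝ (v k) (v l) = if k = l then (2 * q : ℝ) else 0 := fun k l => by
    rw [← huu]
    exact inner_embedding_imagUnit_mul_imagUnit_mul σ _ _
  have huv : ∀ k l, inner ℝ (u k) (v l) = 0 := fun k l =>
    inner_embedding_imagUnit_mul hq8 σ _ _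
  have hsum : ∀ n m : Fin 4 → ℤ, σ.embedding (inclKL q (∑ k, n k • frame q a b k) +
      imagUnit q * inclKL q (∑ k, m k • frame q a b k)) =
        ∑ k, n k • u k + ∑ k, m k • v k := by
    intro n m
    simp only [map_add, map_sum, map_zsmul, Finset.mul_sum, mul_smul_comm, u, v]
  have hΛ : ∀ x, x ∈ (moduleS fun k => (z k : fieldK q)).map σ.embedding ↔
      ∃ n m : Fin 4 → ℤ, Even (∑ k, n k) ∧ Even (∑ k, m k) ∧
        x = ∑ k, n k • u k + ∑ k, m k • v k := by
    intro x
    rw [Submodule.mem_map]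
    constructor
    · rintro ⟨y, hy, rfl⟩
      obtain ⟨y₁, h₁, y₂, h₂, rfl⟩ := (mem_moduleS_iff z y).1 hy
      obtain ⟨n, hn, rfl⟩ := (hM y₁).1 h₁
      obtain ⟨m, hm, rfl⟩ := (hM y₂).1 h₂
      exact ⟨n, m, hn, hm, hsum n m⟩
    · rintro ⟨n, m, hn, hm, rfl⟩
      exact ⟨_, (mem_moduleS_iff z _).2 ⟨_, (hM _).2 ⟨n, hn, rfl⟩, _, (hM _).2 ⟨m, hm, rfl⟩, rfl⟩,
        hsum n m⟩
  have hq0 : (0 : ℝ) < 2 * q := by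
    have : 0 < q := by omega
    positivity
  obtain ⟨hequiv, hspan⟩ := equivalent_orthogonalSum_latticeD (n := 4) (by simp) hq0 u v huu hvv huv
    _ hΛ
  refine ⟨hequiv, ?_, ?_⟩
  · -- Eight vectors that span `ℝ⁸` are linearly independent.
    apply linearIndependent_of_top_le_span_of_card_eq_finrank
    · rw [moduleS, Submodule.map_span, Submodule.span_span_of_tower, ← Set.range_comp] at hspan
      exact hspan.ge
    · simp
  · choose c hc using fun k => exists_ofCoords_of_mem_moduleM (z k).2
    ext (k | k) (l | l) <;>
      simp only [Matrix.gram_apply, generators, Sum.elim_inl, Sum.elim_inr, Matrix.smul_apply,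
        Matrix.fromBlocks_apply₁₁, Matrix.fromBlocks_apply₁₂, Matrix.fromBlocks_apply₂₁,
        Matrix.fromBlocks_apply₂₂, Matrix.zero_apply, smul_eq_mul, mul_zero, hc]
    · rw [inner_embedding_fieldL hq8, inner_embedding_fieldK hq8]
    · exact inner_embedding_imagUnit_mul hq8 σ _ _
    · rw [real_inner_comm]
      exact inner_embedding_imagUnit_mul hq8 σ _ _
    · rw [inner_embedding_imagUnit_mul_imagUnit_mul, inner_embedding_fieldL hq8,
        inner_embedding_fieldK hq8]
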